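/- Let $\beta>1$. For real $t$ put $\langle t\rangle=1$ if $t\in\mathbb Z$ and $\langle t\rangle=t-\lfloor t\rfloor$ otherwise; for $x\in[0,1]$ let $\overline{T}_\beta(x)=\langle\beta x\rangle$, let $\overline{d}_\beta(x)=x_1x_2\cdots$ be the word with letters $x_i=\lceil\beta\,\overline{T}_\beta^{\,i-1}(x)\rceil-1$, and let $\mathrm{Diam}_\beta(x)=\sup_{n\ge0}\overline{T}_\beta^{\,n}(x)-\inf_{n\ge0}\overline{T}_\beta^{\,n}(x)$. The frequency of $x$ is the limit of $\frac1n\sum_{i=1}^n x_i$. A word $(w_n)_{n\ge0}$ is mechanical of slope $\alpha\ge0$ if for some $\rho\in[0,1]$ either $w_n=\lfloor\alpha(n+1)+\rho\rfloor-\lfloor\alpha n+\rho\rfloor$ for all $n$, or $w_n=\lceil\alpha(n+1)+\rho\rceil-\lceil\alpha n+\rho\rceil$ for all $n$; it is Sturmian of slope $\alpha$ if moreover $\alpha$ is irrational. A skew word of slope $r\in\mathbb Q$ is an infinite word over two consecutive integers $a$ and $b=a+1$ (both of which occur) that is balanced (the numbers of $b$ in any two factors of the same length differ by at most one), is not recurrent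 (some factor occurs only finitely often), and becomes a mechanical word of slope $r$ after removal of some nonempty prefix. There is exactly one real number, denoted $\mathrm{Freq}(\beta)$, that is the common frequency of all points of some orbit closure $K$ of $\overline{T}_\beta$ with $K\subset[1-\frac1\beta,1]$ and $\overline{T}_\beta(K)=K$. If $\xi\in[0,1]$ satisfies $\mathrm{Diam}_\beta(\xi)\le 1/\beta$, then exactly one of the following holds: (a) $\overline{d}_\beta(\xi)$ is a Sturmian word of slope at most $\mathrm{Freq}(\beta)$, and $\mathrm{Diam}_\beta(\xi)=1/\beta$; (b) for some rational $p/q\le\mathrm{Freq}(\beta)$ in lowest terms ($q\ge1$), $\overline{d}_\beta(\xi)$ is a mechanical word of slope $p/q$, and $\mathrm{Diam}_\beta(\xi)=\frac{\beta^{q-1}-1}{\beta^q-1}$; (c) for some rational $p/q\le\mathrm{Freq}(\beta)$ in lowest terms ($q\ge1$), $\overline{d}_\beta(\xi)$ is a skew word of slope $p/q$, and $\mathrm{Diam}_\beta(\overline{T}_\beta^{\,k}(\xi))=\frac{\beta^{q-1}-1}{\beta^q-1}$ for all sufficiently large $k$. -/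

import Mathlib

noncomputable section

/-! ### Infinite words over the integers -/

/-- The word `w` with its first `m` letters removed. -/
def shiftWord (m : ℕ) (w : ℕ → ℤ) : ℕ → ℤ := fun n => w (m + n)

/-- The lower mechanical word of slope `α` and intercept `ρ`. -/
def lowerMechanical (α ρ : ℝ) (n : ℕ) : ℤ := ⌊α * (n + 1) + ρ⌋ - ⌊α * n + ρ⌋

/-- The upper mechanical word of slope `α` and intercept `ρ`. -/
def upperMechanical (α ρ : ℝ) (n : ℕ) : ℤ := ⌈α * (n + 1) + ρ⌉ - ⌈α * n + ρ⌉

/-- `w` is a (lower or upper) mechanical word of slope `α`. -/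
def IsMechanical (w : ℕ → ℤ) (α : ℝ) : Prop :=
  0 ≤ α ∧ ∃ ρ ∈ Set.Icc (0 : ℝ) 1, w = lowerMechanical α ρ ∨ w = upperMechanical α ρ

/-- `w` is a Sturmian word of slope `α`: a mechanical word of irrational slope. -/
def IsSturmian (w : ℕ → ℤ) (α : ℝ) : Prop := Irrational α ∧ IsMechanical w α

/-- The number of occurrences of the letter `c` in the factor of `w` of length `n` that
starts at position `i`. -/
def factorCount (w : ℕ → ℤ) (c : ℤ) (i n : ℕ) : ℕ :=
  ((Finset.range n).filter fun k => w (i + k) = c).card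

/-- `w` is a balanced binary word, over two consecutive integers `a` and `b = a + 1`: two factors
of the same length have numbers of `b` that differ by at most one. -/
def IsBalanced (w : ℕ → ℤ) : Prop :=
  ∃ a b : ℤ, b = a + 1 ∧ Set.range w = {a, b} ∧
    ∀ n i j : ℕ, factorCount w b i n ≤ factorCount w b j n + 1

/-- `w` is recurrent: each of its factors occurs at arbitrarily late positions. -/
def IsRecurrent (w : ℕ → ℤ) : Prop :=
  ∀ i n N : ℕ, ∃ j, N ≤ j ∧ ∀ k < n, w (j + k) = w (i + k)

/-- `w` is a skew word of slope `r`: a balanced non-recurrent word which, after a nonempty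
prefix, is a mechanical word of rational slope `r`. -/
def IsSkew (w : ℕ → ℤ) (r : ℚ) : Prop :=
  IsBalanced w ∧ ¬ IsRecurrent w ∧ ∃ m : ℕ, 0 < m ∧ IsMechanical (shiftWord m w) (r : ℝ)

/-! ### The left-continuous beta-transformation and its expansions -/

/-- The fractional part of `t`, with the value `1` instead of `0` at integers. -/
def upperFract (t : ℝ) : ℝ := if Int.fract t = 0 then 1 else Int.fract t

/-- The transformation `x ↦ ⟨β x⟩` of `[0, 1]`. -/
def betaMap (β x : ℝ) : ℝ := upperFract (β * x)

/-- The expansion of `x`; the letter at position `n` is `⌈β Tⁿ(x)⌉ - 1`, with `T = betaMap β`. -/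
def betaExpansion (β x : ℝ) (n : ℕ) : ℤ := ⌈β * (betaMap β)^[n] x⌉ - 1

/-- The orbit of `x`, including `x`. -/
def betaOrbit (β x : ℝ) : Set ℝ := Set.range fun n : ℕ => (betaMap β)^[n] x

/-- The supremum of the orbit of `x` minus its infimum. -/
def betaDiam (β x : ℝ) : ℝ := (⨆ n : ℕ, (betaMap β)^[n] x) - ⨅ n : ℕ, (betaMap β)^[n] x

/-- The point `x` has frequency `α`: the average of the first `n` letters of its expansion
converges to `α`. -/
def HasFrequency (β x α : ℝ) : Prop :=
  Filter.Tendsto (fun n : ℕ => (∑ k ∈ Finset.range n, (betaExpansion β x k : ℝ)) / n)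
    Filter.atTop (nhds α)

/-- `α` is the frequency (common to all points) of an invariant orbit closure that is contained
in the interval `[1 - 1/β, 1]`. -/
def IsTopFrequency (β α : ℝ) : Prop :=
  ∃ x ∈ Set.Icc (0 : ℝ) 1,
    closure (betaOrbit β x) ⊆ Set.Icc (1 - 1 / β) 1 ∧
    betaMap β '' closure (betaOrbit β x) = closure (betaOrbit β x) ∧
    ∀ y ∈ closure (betaOrbit β x), HasFrequency β y α

/-- `Freq β` is the frequency of the invariant orbit closure contained in `[1 - 1/β, 1]`. -/
def Freq (β : ℝ) : ℝ := Classical.epsilon (IsTopFrequency β)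

/-! ### The three cases -/

def SturmianCase (β ξ : ℝ) : Prop :=
  (∃ α : ℝ, α ≤ Freq β ∧ IsSturmian (betaExpansion β ξ) α) ∧ betaDiam β ξ = 1 / β

/-- The rational slope is `r = p / q` in lowest terms, so that `q = r.den`. -/
def MechanicalCase (β ξ : ℝ) : Prop :=
  ∃ r : ℚ, (r : ℝ) ≤ Freq β ∧ IsMechanical (betaExpansion β ξ) (r : ℝ) ∧
    betaDiam β ξ = (β ^ (r.den - 1) - 1) / (β ^ r.den - 1)

/-- The rational slope is `r = p / q` in lowest terms, so that `q = r.den`. -/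
def SkewCase (β ξ : ℝ) : Prop :=
  ∃ r : ℚ, (r : ℝ) ≤ Freq β ∧ IsSkew (betaExpansion β ξ) r ∧
    ∃ K : ℕ, ∀ k : ℕ, K ≤ k →
      betaDiam β ((betaMap β)^[k] ξ) = (β ^ (r.den - 1) - 1) / (β ^ r.den - 1)

end

/-! An orbit satisfies `β * x n = w n + x (n + 1)` with all points in `(0, 1]`. If two orbits stay
within `1/β` of each other, the gap between two points is stretched to a number in `[0, 1]`, so
their letters agree and the order of the points persists, or the letters differ by one and the order
is reversed. Hence the partial letter sums differ by 0 or 1 forever, in favour of the larger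
starting point (`IsBetaOrbit.compare`). For an orbit of diameter at most `1/β` it follows that the
word is balanced and that its factor sums are monotone in the orbit point.

A balanced word has a slope `α`, and its prefix sums stay in a closed strip of height one around a
line of slope `α`. Either one edge of the strip is never touched and the word is mechanical, or both
edges are touched; then `α` is rational, the deviation cannot switch back, and the word is skew
(`SumBalanced.isMechanical_or_isSkew`).

Summation by parts writes a point as `(1 - 1/β) ∑ F(n) β⁻ⁿ`, where `F(n)` is the sum of its first
`n` letters. For a mechanical word `F(n)` lies between `⌊αn⌋` and `⌈αn⌉`, and monotonicity shows
that the supremum and infimum of the orbit are the values of these two sequences. The diameter is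
therefore an explicit series in `⌈αn⌉ - ⌊αn⌋`.

Raising every `F(n)` with `n ≥ 1` by one adds exactly `1/β`. So if the floor value of `α` is at
least `1 - 1/β`, any larger slope has ceiling value above 1 (`one_lt_betaValue_ceil`). This gives
both the uniqueness of the top frequency and the bound by `Freq β`. The largest slope with ceiling
value at most 1 supplies existence. The three cases exclude each other because slopes are unique,
and because a mechanical word of rational slope is periodic, hence recurrent. -/

section Words

open Filter Topology

/-! ### Factor sums, balance and slope -/

/-- The sum of the letters of the factor of `w` of length `n` that starts at position `i`. -/
def factorSum (w : ℕ → ℤ) (i n : ℕ) : ℤ := ∑ k ∈ Finset.range n, w (i + k)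

/-- Factors of `w` of equal length have sums that differ by at most one. -/
def SumBalanced (w : ℕ → ℤ) : Prop := ∀ n i j, factorSum w i n ≤ factorSum w j n + 1

/-- The averages of the prefixes of `w` converge to `α`. -/
def HasSlope (w : ℕ → ℤ) (α : ℝ) : Prop :=
  Tendsto (fun n : ℕ => (factorSum w 0 n : ℝ) / n) atTop (𝓝 α)

@[simp] lemma factorSum_zero (w : ℕ → ℤ) (i : ℕ) : factorSum w i 0 = 0 := by simp [factorSum]

lemma factorSum_succ (w : ℕ → ℤ) (i n : ℕ) :
    factorSum w i (n + 1) = factorSum w i n + w (i + n) := by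
  simp [factorSum, Finset.sum_range_succ]

lemma factorSum_one (w : ℕ → ℤ) (i : ℕ) : factorSum w i 1 = w i := by simp [factorSum]

lemma factorSum_add (w : ℕ → ℤ) (i m n : ℕ) :
    factorSum w i (m + n) = factorSum w i m + factorSum w (i + m) n := by
  simp [factorSum, Finset.sum_range_add, add_assoc]

lemma factorSum_eq_sub (w : ℕ → ℤ) (i n : ℕ) :
    factorSum w i n = factorSum w 0 (i + n) - factorSum w 0 i := by
  rw [factorSum_add]; simp

lemma factorSum_succ' (w : ℕ → ℤ) (i n : ℕ) :
    factorSum w i (n + 1) = w i + factorSum w (i + 1) n := by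
  rw [add_comm n 1, factorSum_add, factorSum_one]

lemma factorSum_shiftWord (w : ℕ → ℤ) (m i n : ℕ) :
    factorSum (shiftWord m w) i n = factorSum w (m + i) n := by
  simp [factorSum, shiftWord, add_assoc]

lemma factorSum_nonneg {w : ℕ → ℤ} (hw : ∀ n, 0 ≤ w n) (i n : ℕ) : 0 ≤ factorSum w i n :=
  Finset.sum_nonneg fun _ _ => hw _

lemma factorSum_mul_le {w : ℕ → ℤ} {n : ℕ} {c : ℤ} (h : ∀ i, factorSum w i n ≤ c) (i k : ℕ) :
    factorSum w i (k * n) ≤ k * c := by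
  induction k with
  | zero => simp
  | succ k ih =>
    rw [Nat.succ_mul, factorSum_add]
    push_cast
    linarith [h (i + k * n)]

lemma factorSum_neg (w : ℕ → ℤ) (i n : ℕ) :
    factorSum (fun k => -w k) i n = -factorSum w i n := by simp [factorSum]

lemma HasSlope.neg {w : ℕ → ℤ} {α : ℝ} (h : HasSlope w α) : HasSlope (fun k => -w k) (-α) := by
  refine (Tendsto.neg h).congr fun n => ?_
  rw [factorSum_neg]; push_cast; ring

/-- A prefix of length `k * n` splits into `k` factors of length `n`, and the averages along
multiples of `n` still converge to `α`. -/
lemma HasSlope.mul_le {w : ℕ → ℤ} {α : ℝ} (hα : HasSlope w α) {n : ℕ} {c : ℤ}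
    (h : ∀ i, factorSum w i n ≤ c) : α * n ≤ c := by
  rcases Nat.eq_zero_or_pos n with rfl | hn
  · have := h 0
    simp at this ⊢
    exact_mod_cast this
  have hn' : (0 : ℝ) < n := by exact_mod_cast hn
  have ht : Tendsto (fun k : ℕ => k * n) atTop atTop :=
    tendsto_id.atTop_mul_const' hn
  have h1 := hα.comp ht
  rw [← le_div_iff₀ hn']
  refine le_of_tendsto h1 ?_
  filter_upwards [eventually_gt_atTop 0] with k hk
  have hk' : (0 : ℝ) < k := by exact_mod_cast hk
  have h2 : (factorSum w 0 (k * n) : ℝ) ≤ k * c := by exact_mod_cast factorSum_mul_le h 0 k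
  simp only [Function.comp]
  push_cast
  rw [div_le_div_iff₀ (by positivity) hn']
  nlinarith

lemma HasSlope.le_mul {w : ℕ → ℤ} {α : ℝ} (hα : HasSlope w α) {n : ℕ} {c : ℤ}
    (h : ∀ i, c ≤ factorSum w i n) : (c : ℝ) ≤ α * n := by
  have := hα.neg.mul_le (n := n) (c := -c) fun i => by rw [factorSum_neg]; linarith [h i]
  push_cast at this
  linarith

/-- Integer sums all below `⌈α n⌉` are at most `⌈α n⌉ - 1 < α n`, which would make the slope too
small. -/
lemma HasSlope.exists_ceil_le {w : ℕ → ℤ} {α : ℝ} (hα : HasSlope w α) (n : ℕ) :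
    ∃ i, ⌈α * n⌉ ≤ factorSum w i n := by
  by_contra! h
  have := hα.mul_le (n := n) (c := ⌈α * n⌉ - 1) fun i => by have := h i; omega
  push_cast at this
  linarith [Int.ceil_lt_add_one (α * n)]

lemma HasSlope.exists_le_floor {w : ℕ → ℤ} {α : ℝ} (hα : HasSlope w α) (n : ℕ) :
    ∃ i, factorSum w i n ≤ ⌊α * n⌋ := by
  by_contra! h
  have := hα.le_mul (n := n) (c := ⌊α * n⌋ + 1) fun i => by have := h i; omega
  push_cast at this
  linarith [Int.lt_floor_add_one (α * n)]

lemma HasSlope.factorSum_le {w : ℕ → ℤ} {α : ℝ} (hα : HasSlope w α) (hb : SumBalanced w)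
    (i n : ℕ) : (factorSum w i n : ℝ) ≤ α * n + 1 := by
  have := hα.le_mul (n := n) (c := factorSum w i n - 1) fun j => by linarith [hb n i j]
  push_cast at this
  linarith

lemma HasSlope.le_factorSum {w : ℕ → ℤ} {α : ℝ} (hα : HasSlope w α) (hb : SumBalanced w)
    (i n : ℕ) : α * n ≤ factorSum w i n + 1 := by
  have := hα.mul_le (n := n) (c := factorSum w i n + 1) fun j => by linarith [hb n j i]
  push_cast at this
  linarith

lemma HasSlope.nonneg {w : ℕ → ℤ} {α : ℝ} (hα : HasSlope w α) (hw : ∀ n, 0 ≤ w n) : 0 ≤ α :=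
  ge_of_tendsto' hα fun n => by
    have : (0 : ℝ) ≤ factorSum w 0 n := by exact_mod_cast factorSum_nonneg hw 0 n
    positivity

lemma hasSlope_of_abs_sub_le {w : ℕ → ℤ} {α C : ℝ}
    (h : ∀ n : ℕ, |(factorSum w 0 n : ℝ) - α * n| ≤ C) : HasSlope w α := by
  rw [HasSlope, tendsto_iff_norm_sub_tendsto_zero]
  have h0 : Tendsto (fun n : ℕ => C / (n : ℝ)) atTop (𝓝 0) :=
    tendsto_const_nhds.div_atTop tendsto_natCast_atTop_atTop
  refine squeeze_zero' (Eventually.of_forall fun _ => norm_nonneg _) ?_ h0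
  filter_upwards [eventually_gt_atTop 0] with n hn
  have hn' : (0 : ℝ) < n := by exact_mod_cast hn
  rw [Real.norm_eq_abs, show (factorSum w 0 n : ℝ) / n - α = (factorSum w 0 n - α * n) / n by
    field_simp, abs_div, abs_of_pos hn']
  gcongr
  exact h n

lemma HasSlope.shiftWord {w : ℕ → ℤ} {α : ℝ} (hα : HasSlope w α) (hb : SumBalanced w) (m : ℕ) :
    HasSlope (shiftWord m w) α :=
  hasSlope_of_abs_sub_le (C := 1) fun n => by
    rw [factorSum_shiftWord, abs_le]
    constructor <;> linarith [hα.factorSum_le hb (m + 0) n, hα.le_factorSum hb (m + 0) n]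

lemma SumBalanced.shiftWord {w : ℕ → ℤ} (hb : SumBalanced w) (m : ℕ) :
    SumBalanced (shiftWord m w) := fun n i j => by
  simpa only [factorSum_shiftWord] using hb n (m + i) (m + j)

/-- Balance makes the prefix sums plus one subadditive, so Fekete's lemma applies; the extra one
vanishes after division by `n`. -/
lemma SumBalanced.exists_hasSlope {w : ℕ → ℤ} (hb : SumBalanced w) (hw : ∀ n, 0 ≤ w n) :
    ∃ α, HasSlope w α := by
  have hs : Subadditive fun n => (factorSum w 0 n : ℝ) + 1 := fun m n => by
    beta_reduce
    rw [factorSum_add]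
    have : (factorSum w (0 + m) n : ℝ) ≤ factorSum w 0 n + 1 := by exact_mod_cast hb n _ _
    push_cast
    linarith
  have hbdd : BddBelow (Set.range fun n : ℕ => ((factorSum w 0 n : ℝ) + 1) / n) := by
    refine ⟨0, ?_⟩
    rintro _ ⟨n, rfl⟩
    have : (0 : ℝ) ≤ factorSum w 0 n := by exact_mod_cast factorSum_nonneg hw 0 n
    positivity
  refine ⟨hs.lim, ?_⟩
  have h0 : Tendsto (fun n : ℕ => (1 : ℝ) / n) atTop (𝓝 0) :=
    tendsto_const_nhds.div_atTop tendsto_natCast_atTop_atTop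
  have := (hs.tendsto_lim hbdd).sub h0
  rw [sub_zero] at this
  exact this.congr fun n => by ring

/-! ### Mechanical words -/

lemma factorSum_lowerMechanical (α ρ : ℝ) (i n : ℕ) :
    factorSum (lowerMechanical α ρ) i n = ⌊α * (i + n : ℕ) + ρ⌋ - ⌊α * i + ρ⌋ := by
  induction n with
  | zero => simp
  | succ n ih =>
    rw [factorSum_succ, ih, lowerMechanical]
    push_cast
    rw [add_assoc (i : ℝ)]
    ring

lemma factorSum_upperMechanical (α ρ : ℝ) (i n : ℕ) :
    factorSum (upperMechanical α ρ) i n = ⌈α * (i + n : ℕ) + ρ⌉ - ⌈α * i + ρ⌉ := by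
  induction n with
  | zero => simp
  | succ n ih =>
    rw [factorSum_succ, ih, upperMechanical]
    push_cast
    rw [add_assoc (i : ℝ)]
    ring

lemma ceil_add_sub_ceil_le (a b : ℝ) : ⌈a + b⌉ - ⌈b⌉ ≤ ⌈a⌉ := by
  linarith [Int.ceil_add_le a b]

lemma floor_le_ceil_add_sub_ceil (a b : ℝ) : ⌊a⌋ ≤ ⌈a + b⌉ - ⌈b⌉ := by
  have : ⌈b + ⌊a⌋⌉ ≤ ⌈a + b⌉ := Int.ceil_mono (by linarith [Int.floor_le a])
  rw [Int.ceil_add_intCast] at this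
  linarith

lemma floor_le_floor_add_sub_floor (a b : ℝ) : ⌊a⌋ ≤ ⌊a + b⌋ - ⌊b⌋ := by
  linarith [Int.le_floor_add a b]

lemma floor_add_sub_floor_le_ceil (a b : ℝ) : ⌊a + b⌋ - ⌊b⌋ ≤ ⌈a⌉ := by
  have : ⌊a + b⌋ ≤ ⌊b + ⌈a⌉⌋ := Int.floor_mono (by linarith [Int.le_ceil a])
  rw [Int.floor_add_intCast] at this
  linarith

lemma IsMechanical.floor_le_factorSum {w : ℕ → ℤ} {α : ℝ} (h : IsMechanical w α) (i n : ℕ) :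
    ⌊α * n⌋ ≤ factorSum w i n := by
  obtain ⟨-, ρ, -, rfl | rfl⟩ := h
  · rw [factorSum_lowerMechanical]
    convert floor_le_floor_add_sub_floor (α * n) (α * i + ρ) using 3
    push_cast; ring
  · rw [factorSum_upperMechanical]
    convert floor_le_ceil_add_sub_ceil (α * n) (α * i + ρ) using 3
    push_cast; ring

lemma IsMechanical.factorSum_le_ceil {w : ℕ → ℤ} {α : ℝ} (h : IsMechanical w α) (i n : ℕ) :
    factorSum w i n ≤ ⌈α * n⌉ := by
  obtain ⟨-, ρ, -, rfl | rfl⟩ := h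
  · rw [factorSum_lowerMechanical]
    convert floor_add_sub_floor_le_ceil (α * n) (α * i + ρ) using 3
    push_cast; ring
  · rw [factorSum_upperMechanical]
    convert ceil_add_sub_ceil_le (α * n) (α * i + ρ) using 3
    push_cast; ring

lemma IsMechanical.hasSlope {w : ℕ → ℤ} {α : ℝ} (h : IsMechanical w α) : HasSlope w α :=
  hasSlope_of_abs_sub_le (C := 1) fun n => by
    have h1 : (⌊α * n⌋ : ℝ) ≤ factorSum w 0 n := by exact_mod_cast h.floor_le_factorSum 0 n
    have h2 : (factorSum w 0 n : ℝ) ≤ ⌈α * n⌉ := by exact_mod_cast h.factorSum_le_ceil 0 n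
    rw [abs_le]
    constructor <;> linarith [Int.lt_floor_add_one (α * n), Int.ceil_lt_add_one (α * n)]

lemma HasSlope.unique {w : ℕ → ℤ} {α α' : ℝ} (h : HasSlope w α) (h' : HasSlope w α') : α = α' :=
  tendsto_nhds_unique h h'

lemma isMechanical_shiftWord {w : ℕ → ℤ} {α : ℝ} (h : IsMechanical w α) (m : ℕ) :
    IsMechanical (shiftWord m w) α := by
  obtain ⟨h0, ρ, hρ, rfl | rfl⟩ := h
  · refine ⟨h0, Int.fract (α * m + ρ), ⟨Int.fract_nonneg _, (Int.fract_lt_one _).le⟩, .inl ?_⟩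
    funext n
    have e (t : ℝ) : ⌊t + (α * m + ρ)⌋ = ⌊t + Int.fract (α * m + ρ)⌋ + ⌊α * m + ρ⌋ := by
      rw [← Int.floor_add_intCast, add_assoc, Int.fract_add_floor]
    simp only [shiftWord, lowerMechanical]
    push_cast
    rw [show α * (m + n + 1) + ρ = α * (n + 1) + (α * m + ρ) by ring,
      show α * (m + n) + ρ = α * n + (α * m + ρ) by ring, e, e]
    ring
  · refine ⟨h0, Int.fract (α * m + ρ), ⟨Int.fract_nonneg _, (Int.fract_lt_one _).le⟩, .inr ?_⟩
    funext n
    have e (t : ℝ) : ⌈t + (α * m + ρ)⌉ = ⌈t + Int.fract (α * m + ρ)⌉ + ⌊α * m + ρ⌋ := by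
      rw [← Int.ceil_add_intCast, add_assoc, Int.fract_add_floor]
    simp only [shiftWord, upperMechanical]
    push_cast
    rw [show α * (m + n + 1) + ρ = α * (n + 1) + (α * m + ρ) by ring,
      show α * (m + n) + ρ = α * n + (α * m + ρ) by ring, e, e]
    ring

lemma IsMechanical.periodic {w : ℕ → ℤ} {r : ℚ} (h : IsMechanical w (r : ℝ)) :
    Function.Periodic w r.den := by
  have hq : (r : ℝ) * r.den = r.num := by exact_mod_cast Rat.mul_den_eq_num r
  obtain ⟨-, ρ, -, rfl | rfl⟩ := h
  · intro n
    simp only [lowerMechanical]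
    push_cast
    rw [show (r : ℝ) * (n + r.den + 1) + ρ = r * (n + 1) + ρ + r.num by rw [← hq]; ring,
      show (r : ℝ) * (n + r.den) + ρ = r * n + ρ + r.num by rw [← hq]; ring,
      Int.floor_add_intCast, Int.floor_add_intCast]
    ring
  · intro n
    simp only [upperMechanical]
    push_cast
    rw [show (r : ℝ) * (n + r.den + 1) + ρ = r * (n + 1) + ρ + r.num by rw [← hq]; ring,
      show (r : ℝ) * (n + r.den) + ρ = r * n + ρ + r.num by rw [← hq]; ring,
      Int.ceil_add_intCast, Int.ceil_add_intCast]
    ring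

lemma isRecurrent_of_periodic {w : ℕ → ℤ} {q : ℕ} (hq : 0 < q) (h : Function.Periodic w q) :
    IsRecurrent w := fun i n N => by
  refine ⟨i + N * q, by nlinarith, fun k _ => ?_⟩
  rw [show i + N * q + k = i + k + N * q by ring]
  exact h.nat_mul N (i + k)

/-! ### Classification of balanced words -/

/-- Here `D` is the deviation of the prefix sums from one edge of a strip of height one. Once it has
passed from 0 to 1, balance forbids a return to 0: a full rise and a full fall would propagate along
two arithmetic progressions that meet. -/
lemma ne_zero_of_switch {D : ℕ → ℝ} (h0 : ∀ n, 0 ≤ D n) (h1 : ∀ n, D n ≤ 1)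
    (hD : ∀ n i j, D (i + n) - D i ≤ D (j + n) - D j + 1) {n m : ℕ} (hnm : n < m)
    (hn : D n = 0) (hm : D m = 1) {k : ℕ} (hk : m ≤ k) : D k ≠ 0 := by
  intro hk0
  obtain ⟨a, rfl⟩ := Nat.exists_eq_add_of_lt hnm
  obtain ⟨b, rfl⟩ := Nat.exists_eq_add_of_le hk
  set L := a + 1 with hL
  have e : n + a + 1 = n + L := by omega
  rw [e] at hm hk0
  -- `D` falls by 1 over the `b` steps from `n + L`, so no `b`-step increment is positive and zeros
  -- propagate.
  have A : ∀ t, D (n + b * t) = 0 := by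
    intro t
    induction t with
    | zero => simpa using hn
    | succ t ih =>
      have := hD b (n + b * t) (n + L)
      rw [show n + b * t + b = n + b * (t + 1) by ring] at this
      linarith [h0 (n + b * (t + 1))]
  -- `D` rises by 1 over the `L` steps from `n`, so no `L`-step increment is negative and ones
  -- propagate.
  have B : ∀ t, D (n + L * (t + 1)) = 1 := by
    intro t
    induction t with
    | zero => simpa using hm
    | succ t ih =>
      have := hD L n (n + L * (t + 1))
      rw [show n + L * (t + 1) + L = n + L * (t + 1 + 1) by ring] at this
      linarith [h1 (n + L * (t + 1 + 1))]
  rcases b with _ | b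
  · simp at hk0
    linarith
  · have h2 := A L
    rw [mul_comm, B b] at h2
    norm_num at h2

lemma factorSum_eq_of_forall_eq {w : ℕ → ℤ} {i j n : ℕ} (h : ∀ k < n, w (j + k) = w (i + k)) :
    factorSum w j n = factorSum w i n :=
  Finset.sum_congr rfl fun k hk => h k (Finset.mem_range.1 hk)

/-- A non-recurrent word is not constant, so balance on single letters leaves exactly two
consecutive integers; a factor sum is then a constant multiple of the length plus the number of
larger letters. -/
lemma SumBalanced.isBalanced {w : ℕ → ℤ} (hb : SumBalanced w) (hr : ¬ IsRecurrent w) :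
    IsBalanced w := by
  have hb1 (i j : ℕ) : w i ≤ w j + 1 := by simpa [factorSum_one] using hb 1 i j
  have : ∃ i j, w i < w j := by
    by_contra! h
    exact hr fun i n N => ⟨N, le_rfl, fun k _ => le_antisymm (h _ _) (h _ _)⟩
  obtain ⟨i, j, hij⟩ := this
  have hj : w j = w i + 1 := by have := hb1 j i; omega
  have hk (k : ℕ) : w k = w i ∨ w k = w i + 1 := by
    have := hb1 k i
    have := hb1 j k
    omega
  refine ⟨w i, w i + 1, rfl, ?_, ?_⟩
  · ext z
    simp only [Set.mem_range, Set.mem_insert_iff, Set.mem_singleton_iff]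
    constructor
    · rintro ⟨k, rfl⟩
      exact hk k
    · rintro (rfl | rfl)
      exacts [⟨i, rfl⟩, ⟨j, hj⟩]
  · have key (l n : ℕ) : factorSum w l n = n * w i + factorCount w (w i + 1) l n := by
      rw [factorSum, factorCount, Finset.card_filter]
      push_cast
      rw [← nsmul_eq_mul, ← Finset.card_range n, ← Finset.sum_const, Finset.card_range,
        ← Finset.sum_add_distrib]
      refine Finset.sum_congr rfl fun k _ => ?_
      rcases hk (l + k) with h | h <;> simp [h]
    intro n l m
    have := hb n l m
    rw [key, key] at this
    omega

lemma isMechanical_of_lower {w : ℕ → ℤ} {α ρ : ℝ} (h0 : 0 ≤ α) (hρ : ρ ∈ Set.Icc (0 : ℝ) 1)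
    (h1 : ∀ n, (factorSum w 0 n : ℝ) ≤ α * n + ρ) (h2 : ∀ n, α * n + ρ < factorSum w 0 n + 1) :
    IsMechanical w α := by
  have e (n : ℕ) : ⌊α * n + ρ⌋ = factorSum w 0 n := Int.floor_eq_iff.2 ⟨h1 n, h2 n⟩
  refine ⟨h0, ρ, hρ, .inl ?_⟩
  funext n
  have := e (n + 1)
  push_cast at this
  rw [lowerMechanical, this, e, factorSum_succ]
  simp

lemma isMechanical_of_upper {w : ℕ → ℤ} {α ρ : ℝ} (h0 : 0 ≤ α) (hρ : ρ ∈ Set.Icc (0 : ℝ) 1)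
    (h1 : ∀ n, (factorSum w 0 n : ℝ) < α * n + ρ) (h2 : ∀ n, α * n + ρ ≤ factorSum w 0 n + 1) :
    IsMechanical w α := by
  have e (n : ℕ) : ⌈α * n + ρ⌉ = factorSum w 0 n + 1 :=
    Int.ceil_eq_iff.2 ⟨by push_cast; linarith [h1 n], by push_cast; exact h2 n⟩
  refine ⟨h0, ρ, hρ, .inr ?_⟩
  funext n
  have := e (n + 1)
  push_cast at this
  rw [upperMechanical, this, e, factorSum_succ]
  simp

lemma exists_rat_of_mul_eq {α : ℝ} {z : ℤ} {n m : ℕ} (hnm : n ≠ m)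
    (h : α * m - α * n = z) : ∃ r : ℚ, α = r := by
  have : (m : ℝ) - n ≠ 0 := sub_ne_zero.2 (by exact_mod_cast hnm.symm)
  refine ⟨z / ((m : ℚ) - n), ?_⟩
  push_cast
  rw [eq_div_iff this, ← h]
  ring

/-- A word with balanced factor sums and slope `α` is mechanical of slope `α`, or skew. -/
theorem SumBalanced.isMechanical_or_isSkew {w : ℕ → ℤ} {α : ℝ} (hb : SumBalanced w)
    (h0 : 0 ≤ α) (hα : HasSlope w α) :
    IsMechanical w α ∨ ∃ r : ℚ, α = r ∧ IsSkew w r := by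
  set S : ℕ → ℝ := fun n => factorSum w 0 n with hS
  have hF (i n : ℕ) : (factorSum w i n : ℝ) = S (i + n) - S i := by
    rw [factorSum_eq_sub]; push_cast; rfl
  have hub (m n : ℕ) : S m - α * m ≤ S n - α * n + 1 := by
    rcases le_total n m with h | h
    · obtain ⟨k, rfl⟩ := Nat.exists_eq_add_of_le h
      have := hα.factorSum_le hb n k
      rw [hF] at this
      push_cast
      linarith
    · obtain ⟨k, rfl⟩ := Nat.exists_eq_add_of_le h
      have := hα.le_factorSum hb m k
      rw [hF] at this
      push_cast
      linarith
  -- The least intercept that puts the line on or above all prefix sums; by `hub` the strip of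
  -- height one below the line contains them all.
  set ρ : ℝ := ⨆ n : ℕ, (S n - α * n) with hρdef
  have hbdd : BddAbove (Set.range fun n : ℕ => S n - α * n) :=
    ⟨_, by rintro _ ⟨m, rfl⟩; exact hub m 0⟩
  have l1 (n : ℕ) : S n ≤ α * n + ρ := by linarith [le_ciSup hbdd n]
  have l2 (n : ℕ) : α * n + ρ ≤ S n + 1 := by
    have : ρ ≤ S n - α * n + 1 := ciSup_le fun m => hub m n
    linarith
  have hρ : ρ ∈ Set.Icc (0 : ℝ) 1 := by
    have h1 := l1 0
    have h2 := l2 0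
    simp [hS] at h1 h2
    exact ⟨h1, h2⟩
  by_cases A : ∀ n : ℕ, α * n + ρ ≠ S n + 1
  · exact .inl (isMechanical_of_lower h0 hρ l1 fun n => lt_of_le_of_ne (l2 n) (A n))
  by_cases B : ∀ n : ℕ, S n ≠ α * n + ρ
  · exact .inl (isMechanical_of_upper h0 hρ (fun n => lt_of_le_of_ne (l1 n) (B n)) l2)
  push Not at A B
  obtain ⟨m, hm⟩ := A
  obtain ⟨n, hn⟩ := B
  have hne : n ≠ m := by rintro rfl; linarith
  -- The two contacts with the edges differ by an integer height over `m - n` steps, which forces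
  -- `α` to be rational.
  obtain ⟨r, rfl⟩ : ∃ r : ℚ, α = r :=
    exists_rat_of_mul_eq (z := factorSum w 0 m + 1 - factorSum w 0 n) hne (by
      push_cast; linarith)
  right
  refine ⟨r, rfl, ?_⟩
  have hbal (n i j : ℕ) : S (i + n) - S i ≤ S (j + n) - S j + 1 := by
    rw [← hF, ← hF]; exact_mod_cast hb n i j
  rcases lt_or_gt_of_ne hne with hlt | hlt
  · have key : ∀ k, m ≤ k → r * k + ρ - S k ≠ 0 := fun k hk =>
      ne_zero_of_switch (D := fun k => r * k + ρ - S k) (fun k => by linarith [l1 k])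
        (fun k => by linarith [l2 k])
        (fun n i j => by push_cast; linarith [hbal n j i]) hlt (by simp [hn]) (by simp [hm]) hk
    -- The factor on `[n, m)` raises the deviation from 0 to 1, so a later occurrence would have to
    -- start at deviation 0, which `key` excludes.
    have hr : ¬ IsRecurrent w := fun hrec => by
      obtain ⟨j, hj, hjk⟩ := hrec n (m - n) m
      have h1 := congrArg (Int.cast : ℤ → ℝ) (factorSum_eq_of_forall_eq hjk)
      rw [hF, hF, Nat.add_sub_cancel' hlt.le] at h1
      have h2 := l2 (j + (m - n))
      push_cast [Nat.cast_sub hlt.le] at h2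
      exact key j hj (le_antisymm (by linarith) (by linarith [l1 j]))
    refine ⟨hb.isBalanced hr, hr, m, by omega, ?_⟩
    -- The deviation is 1 at `m`, so the strip seen from there has intercept 1; its upper edge is
    -- never touched again.
    refine isMechanical_of_upper (ρ := 1) h0 (by simp) (fun k => ?_) fun k => ?_
    · rw [factorSum_shiftWord, hF]
      have h1 := lt_of_le_of_ne (l1 (m + k)) (fun h => key (m + k) (by omega) (by rw [h]; ring))
      push_cast [add_zero] at h1 ⊢
      linarith
    · rw [factorSum_shiftWord, hF]
      have h1 := l2 (m + k)
      push_cast [add_zero] at h1 ⊢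
      linarith
  · have key : ∀ k, n ≤ k → 1 - (r * k + ρ - S k) ≠ 0 := fun k hk =>
      ne_zero_of_switch (D := fun k => 1 - (r * k + ρ - S k)) (fun k => by linarith [l2 k])
        (fun k => by linarith [l1 k])
        (fun n i j => by push_cast; linarith [hbal n i j]) hlt (by simp [hm]) (by simp [hn]) hk
    have hr : ¬ IsRecurrent w := fun hrec => by
      obtain ⟨j, hj, hjk⟩ := hrec m (n - m) n
      have h1 := congrArg (Int.cast : ℤ → ℝ) (factorSum_eq_of_forall_eq hjk)
      rw [hF, hF, Nat.add_sub_cancel' hlt.le] at h1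
      have h2 := l1 (j + (n - m))
      push_cast [Nat.cast_sub hlt.le] at h2
      exact key j hj (le_antisymm (by linarith) (by linarith [l2 j]))
    refine ⟨hb.isBalanced hr, hr, n, by omega, ?_⟩
    refine isMechanical_of_lower (ρ := 0) h0 (by simp) (fun k => ?_) fun k => ?_
    · rw [factorSum_shiftWord, hF]
      have h1 := l1 (n + k)
      push_cast [add_zero] at h1 ⊢
      linarith
    · rw [factorSum_shiftWord, hF]
      have h1 := lt_of_le_of_ne (l2 (n + k)) (fun h => key (n + k) (by omega) (by rw [h]; ring))
      push_cast [add_zero] at h1 ⊢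
      linarith

end Words

section Orbits

open Filter Topology

/-! ### Orbits of the beta-transformation -/

/-- `x` is an orbit of the left-continuous beta-transformation, with letters `w`. -/
structure IsBetaOrbit (β : ℝ) (x : ℕ → ℝ) (w : ℕ → ℤ) : Prop where
  pos : ∀ n, 0 < x n
  le_one : ∀ n, x n ≤ 1
  step : ∀ n, β * x n = w n + x (n + 1)

lemma betaMap_eq_sub_ceil (β x : ℝ) : betaMap β x = β * x - (⌈β * x⌉ - 1) := by
  unfold betaMap upperFract
  split_ifs with h
  · obtain ⟨z, hz⟩ := Int.fract_eq_zero_iff.1 h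
    rw [← hz]; simp
  · rw [Int.ceil_eq_add_one_sub_fract h]
    ring

lemma betaMap_pos (β x : ℝ) : 0 < betaMap β x := by
  rw [betaMap_eq_sub_ceil]
  linarith [Int.ceil_lt_add_one (β * x)]

lemma betaMap_le_one (β x : ℝ) : betaMap β x ≤ 1 := by
  rw [betaMap_eq_sub_ceil]
  linarith [Int.le_ceil (β * x)]

lemma isBetaOrbit_iterate (β : ℝ) {x : ℝ} (h0 : 0 < x) (h1 : x ≤ 1) :
    IsBetaOrbit β (fun n => (betaMap β)^[n] x) (betaExpansion β x) where
  pos n := by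
    cases n with
    | zero => exact h0
    | succ n => rw [Function.iterate_succ_apply']; exact betaMap_pos _ _
  le_one n := by
    cases n with
    | zero => exact h1
    | succ n => rw [Function.iterate_succ_apply']; exact betaMap_le_one _ _
  step n := by
    rw [Function.iterate_succ_apply', betaMap_eq_sub_ceil, betaExpansion]
    push_cast
    ring

namespace IsBetaOrbit

variable {β : ℝ} {x x' : ℕ → ℝ} {w w' : ℕ → ℤ}

lemma ceil_eq (h : IsBetaOrbit β x w) (n : ℕ) : ⌈β * x n⌉ = w n + 1 := by
  rw [h.step, Int.ceil_eq_iff]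
  push_cast
  constructor <;> linarith [h.pos (n + 1), h.le_one (n + 1)]

lemma betaMap_eq (h : IsBetaOrbit β x w) (n : ℕ) : betaMap β (x n) = x (n + 1) := by
  rw [betaMap_eq_sub_ceil, h.ceil_eq, h.step]
  push_cast
  ring

lemma iterate_eq (h : IsBetaOrbit β x w) (n : ℕ) : (betaMap β)^[n] (x 0) = x n := by
  induction n with
  | zero => rfl
  | succ n ih => rw [Function.iterate_succ_apply', ih, h.betaMap_eq]

lemma nonneg (h : IsBetaOrbit β x w) (hβ : 0 < β) (n : ℕ) : 0 ≤ w n := by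
  have h1 := mul_pos hβ (h.pos n)
  rw [h.step] at h1
  have h2 : (-1 : ℝ) < w n := by linarith [h.le_one (n + 1)]
  have h3 : -1 < w n := by exact_mod_cast h2
  omega

lemma shift (h : IsBetaOrbit β x w) (m : ℕ) :
    IsBetaOrbit β (fun n => x (m + n)) (shiftWord m w) where
  pos _ := h.pos _
  le_one _ := h.le_one _
  step _ := h.step _

/-- Summation by parts of the base-`β` expansion. It makes a point a nonnegative combination of
factor sums, so inequalities between factor sums become inequalities between points. -/
lemma eq_partial_sum (h : IsBetaOrbit β x w) (hβ : 0 < β) (i N : ℕ) :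
    x i = (1 - β⁻¹) * ∑ n ∈ Finset.range N, (factorSum w i n : ℝ) * β⁻¹ ^ n +
      β⁻¹ ^ N * (factorSum w i N + x (i + N)) := by
  induction N with
  | zero => simp
  | succ N ih =>
    rw [Finset.sum_range_succ, factorSum_succ, ih]
    have h1 := h.step (i + N)
    have h2 : x (i + N) = β⁻¹ * (w (i + N) + x (i + N + 1)) := by
      rw [← h1]; field_simp
    rw [h2, pow_succ]
    push_cast
    rw [← add_assoc]
    ring

/-- The order of two points of orbits that stay close to each other determines the order of the
sums of their letters. -/
lemma compare (h : IsBetaOrbit β x w) (h' : IsBetaOrbit β x' w') (hβ : 0 < β) {i j : ℕ}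
    (hd : ∀ n, |x (i + n) - x' (j + n)| ≤ β⁻¹) (hij : x i ≤ x' j) (n : ℕ) :
    (factorSum w' j n = factorSum w i n ∧ x (i + n) ≤ x' (j + n)) ∨
      (factorSum w' j n = factorSum w i n + 1 ∧ x' (j + n) ≤ x (i + n)) := by
  -- One application of the map: the stretched gap lies in `[0, 1]` and the images lie in `(0, 1]`,
  -- so the letters differ by 0 or 1.
  have step : ∀ {s t s' t' : ℝ} {a b : ℤ}, 0 < s' → s' ≤ 1 → 0 < t' → t' ≤ 1 →
      β * s = a + s' → β * t = b + t' → s ≤ t → t - s ≤ β⁻¹ →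
      (b = a ∧ s' ≤ t') ∨ (b = a + 1 ∧ t' ≤ s') := by
    intro s t s' t' a b hs hs' ht ht' e1 e2 hst hts
    have k1 : 0 ≤ β * (t - s) := mul_nonneg hβ.le (by linarith)
    have k2 : β * (t - s) ≤ 1 := by
      have := mul_le_mul_of_nonneg_left hts hβ.le
      rwa [mul_inv_cancel₀ hβ.ne'] at this
    have k3 : (a : ℝ) - 1 < b := by linarith
    have k4 : (b : ℝ) < a + 2 := by linarith
    have k5 : a - 1 < b := by exact_mod_cast k3
    have k6 : b < a + 2 := by exact_mod_cast k4
    rcases (by omega : b = a ∨ b = a + 1) with rfl | rfl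
    · exact .inl ⟨rfl, by linarith⟩
    · push_cast at e2
      exact .inr ⟨rfl, by linarith⟩
  induction n with
  | zero => simpa using hij
  | succ n ih =>
    rw [factorSum_succ, factorSum_succ, ← add_assoc, ← add_assoc]
    have hn := abs_le.1 (hd n)
    rcases ih with ⟨e, hle⟩ | ⟨e, hle⟩
    · rcases step (h.pos _) (h.le_one _) (h'.pos _) (h'.le_one _) (h.step (i + n))
        (h'.step (j + n)) hle (by linarith) with ⟨e', hl⟩ | ⟨e', hl⟩
      · exact .inl ⟨by rw [e, e'], hl⟩
      · exact .inr ⟨by rw [e, e']; ring, hl⟩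
    · rcases step (h'.pos _) (h'.le_one _) (h.pos _) (h.le_one _) (h'.step (j + n))
        (h.step (i + n)) hle (by linarith) with ⟨e', hl⟩ | ⟨e', hl⟩
      · exact .inr ⟨by rw [e, e']; ring, hl⟩
      · exact .inl ⟨by rw [e, e']; ring, hl⟩

lemma factorSum_mono (h : IsBetaOrbit β x w) (hβ : 0 < β) (ht : ∀ i j, |x i - x j| ≤ β⁻¹)
    {i j : ℕ} (hij : x i ≤ x j) (n : ℕ) : factorSum w i n ≤ factorSum w j n := by
  rcases h.compare h hβ (fun n => ht _ _) hij n with h | h <;> omega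

lemma sumBalanced (h : IsBetaOrbit β x w) (hβ : 0 < β) (ht : ∀ i j, |x i - x j| ≤ β⁻¹) :
    SumBalanced w := fun n i j => by
  rcases le_total (x i) (x j) with hij | hij
  · linarith [h.factorSum_mono hβ ht hij n]
  · rcases h.compare h hβ (fun n => ht _ _) hij n with h | h <;> omega

end IsBetaOrbit

/-! ### Values of sequences of partial sums -/

/-- The number whose digits in base `β` have partial sums `f`. -/
noncomputable def betaValue (β : ℝ) (f : ℕ → ℤ) : ℝ :=
  (1 - β⁻¹) * ∑' n, (f n : ℝ) * β⁻¹ ^ n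

/-- The sequence `f` grows at most linearly. -/
def LinearGrowth (f : ℕ → ℤ) : Prop := ∃ A B : ℝ, ∀ n : ℕ, |(f n : ℝ)| ≤ A * n + B

lemma linearGrowth_floor (α : ℝ) : LinearGrowth fun n => ⌊α * n⌋ :=
  ⟨|α|, 1, fun n => by
    have h1 := Int.floor_le (α * n)
    have h2 := Int.lt_floor_add_one (α * n)
    have h3 := abs_le.1 (abs_mul α n).le
    rw [Nat.abs_cast] at h3
    rw [abs_le]
    constructor <;> linarith⟩

lemma linearGrowth_ceil (α : ℝ) : LinearGrowth fun n => ⌈α * n⌉ :=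
  ⟨|α|, 1, fun n => by
    have h1 := Int.le_ceil (α * n)
    have h2 := Int.ceil_lt_add_one (α * n)
    have h3 := abs_le.1 (abs_mul α n).le
    rw [Nat.abs_cast] at h3
    rw [abs_le]
    constructor <;> linarith⟩

lemma IsMechanical.linearGrowth {w : ℕ → ℤ} {α : ℝ} (h : IsMechanical w α) (i : ℕ) :
    LinearGrowth (factorSum w i) :=
  ⟨|α|, 1, fun n => by
    have h1 : (⌊α * n⌋ : ℝ) ≤ factorSum w i n := by exact_mod_cast h.floor_le_factorSum i n
    have h2 : (factorSum w i n : ℝ) ≤ ⌈α * n⌉ := by exact_mod_cast h.factorSum_le_ceil i n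
    have h3 := abs_le.1 (abs_mul α n).le
    rw [Nat.abs_cast] at h3
    rw [abs_le]
    constructor <;> linarith [Int.lt_floor_add_one (α * n), Int.ceil_lt_add_one (α * n)]⟩

section

variable {β : ℝ} (hβ : 1 < β)
include hβ

lemma summable_linear_mul_pow (A B : ℝ) : Summable fun n : ℕ => (A * n + B) * β⁻¹ ^ n := by
  have hc0 : 0 < β⁻¹ := by positivity
  have hc1 : β⁻¹ < 1 := inv_lt_one_of_one_lt₀ hβ
  have h1 : Summable fun n : ℕ => (n : ℝ) * β⁻¹ ^ n := by
    simpa using summable_pow_mul_geometric_of_norm_lt_one (r := β⁻¹) 1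
      (by rwa [Real.norm_of_nonneg hc0.le])
  have h2 := summable_geometric_of_lt_one hc0.le hc1
  exact ((h1.mul_left A).add (h2.mul_left B)).congr fun n => by ring

lemma LinearGrowth.summable {f : ℕ → ℤ} (hf : LinearGrowth f) :
    Summable fun n => (f n : ℝ) * β⁻¹ ^ n := by
  obtain ⟨A, B, h⟩ := hf
  have hc0 : 0 < β⁻¹ := by positivity
  refine Summable.of_norm_bounded (summable_linear_mul_pow hβ A B) fun n => ?_
  rw [Real.norm_eq_abs, abs_mul, abs_of_pos (pow_pos hc0 n)]
  exact mul_le_mul_of_nonneg_right (h n) (pow_pos hc0 n).le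

lemma LinearGrowth.tendsto_betaValue {f : ℕ → ℤ} (hf : LinearGrowth f) :
    Tendsto (fun N => (1 - β⁻¹) * ∑ n ∈ Finset.range N, (f n : ℝ) * β⁻¹ ^ n) atTop
      (𝓝 (betaValue β f)) :=
  (hf.summable hβ).hasSum.tendsto_sum_nat.const_mul _

lemma betaValue_le {f : ℕ → ℤ} (hf : LinearGrowth f) {C : ℝ}
    (h : ∀ N, (1 - β⁻¹) * ∑ n ∈ Finset.range N, (f n : ℝ) * β⁻¹ ^ n ≤ C) : betaValue β f ≤ C :=
  le_of_tendsto' (hf.tendsto_betaValue hβ) h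

/-- The linear term allows for the remainder in `eq_partial_sum`; multiplied by `β⁻¹ ^ N` it tends
to 0. -/
lemma le_betaValue {f : ℕ → ℤ} (hf : LinearGrowth f) {A B C : ℝ}
    (h : ∀ N : ℕ, C ≤ (1 - β⁻¹) * ∑ n ∈ Finset.range N, (f n : ℝ) * β⁻¹ ^ n +
      β⁻¹ ^ N * (A * N + B)) : C ≤ betaValue β f := by
  have h1 := (hf.tendsto_betaValue hβ).add (summable_linear_mul_pow hβ A B).tendsto_atTop_zero
  rw [add_zero] at h1
  exact ge_of_tendsto' h1 fun N => by simpa only [mul_comm (A * (N : ℝ) + B)] using h N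

lemma betaValue_mono {f g : ℕ → ℤ} (hf : LinearGrowth f) (hg : LinearGrowth g)
    (h : ∀ n, f n ≤ g n) : betaValue β f ≤ betaValue β g := by
  have hc0 : 0 < β⁻¹ := by positivity
  have hc1 : β⁻¹ < 1 := inv_lt_one_of_one_lt₀ hβ
  refine mul_le_mul_of_nonneg_left ?_ (by linarith)
  refine (hf.summable hβ).tsum_le_tsum (fun n => ?_) (hg.summable hβ)
  exact mul_le_mul_of_nonneg_right (by exact_mod_cast h n) (pow_pos hc0 n).le

/-! ### Extreme points and diameter of an orbit -/

namespace IsBetaOrbit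

variable {x : ℕ → ℝ} {w : ℕ → ℤ} {α : ℝ}

/-- For each `n` some factor has sum at least `⌈α n⌉`, but its position depends on `n`. By
monotonicity of factor sums, the largest of finitely many such points serves all these `n` at once.
-/
lemma betaValue_ceil_le (h : IsBetaOrbit β x w) (ht : ∀ i j, |x i - x j| ≤ β⁻¹)
    (hα : HasSlope w α) {C : ℝ} (hC : ∀ i, x i ≤ C) : betaValue β (fun n => ⌈α * n⌉) ≤ C := by
  have hβ0 : 0 < β := by linarith
  have hc0 : 0 < β⁻¹ := by positivity
  have hc1 : β⁻¹ < 1 := inv_lt_one_of_one_lt₀ hβ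
  refine betaValue_le hβ (linearGrowth_ceil α) fun N => ?_
  choose f hf using hα.exists_ceil_le
  obtain ⟨m, -, hm⟩ := Finset.exists_max_image (Finset.range (N + 1)) (fun n => x (f n)) ⟨0, by simp⟩
  refine le_trans ?_ (hC (f m))
  rw [h.eq_partial_sum hβ0 (f m) N]
  have hpos : 0 ≤ β⁻¹ ^ N * (factorSum w (f m) N + x (f m + N)) := by
    have : (0 : ℝ) ≤ factorSum w (f m) N := by
      exact_mod_cast factorSum_nonneg (h.nonneg hβ0) (f m) N
    have := h.pos (f m + N)
    positivity
  refine le_trans ?_ (le_add_of_nonneg_right hpos)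
  refine mul_le_mul_of_nonneg_left (Finset.sum_le_sum fun n hn => ?_) (by linarith)
  refine mul_le_mul_of_nonneg_right ?_ (pow_pos hc0 n).le
  have := h.factorSum_mono hβ0 ht (hm n (by simp at hn ⊢; omega)) n
  exact_mod_cast (hf n).trans this

lemma le_betaValue_floor (h : IsBetaOrbit β x w) (ht : ∀ i j, |x i - x j| ≤ β⁻¹)
    (hα : HasSlope w α) {C : ℝ} (hC : ∀ i, C ≤ x i) : C ≤ betaValue β (fun n => ⌊α * n⌋) := by
  have hβ0 : 0 < β := by linarith
  have hc0 : 0 < β⁻¹ := by positivity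
  have hc1 : β⁻¹ < 1 := inv_lt_one_of_one_lt₀ hβ
  -- `α * N + 2` bounds the remainder: at most `α * N + 1` for the factor sum and 1 for the orbit
  -- point.
  refine le_betaValue hβ (linearGrowth_floor α) (A := α) (B := 2) fun N => ?_
  choose f hf using hα.exists_le_floor
  obtain ⟨m, -, hm⟩ := Finset.exists_min_image (Finset.range (N + 1)) (fun n => x (f n)) ⟨0, by simp⟩
  refine (hC (f m)).trans ?_
  rw [h.eq_partial_sum hβ0 (f m) N]
  refine add_le_add ?_ ?_
  · refine mul_le_mul_of_nonneg_left (Finset.sum_le_sum fun n hn => ?_) (by linarith)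
    refine mul_le_mul_of_nonneg_right ?_ (pow_pos hc0 n).le
    have := h.factorSum_mono hβ0 ht (hm n (by simp at hn ⊢; omega)) n
    exact_mod_cast this.trans (hf n)
  · refine mul_le_mul_of_nonneg_left ?_ (pow_pos hc0 N).le
    linarith [hα.factorSum_le (h.sumBalanced hβ0 ht) (f m) N, h.le_one (f m + N)]

lemma le_betaValue_ceil (h : IsBetaOrbit β x w) (hw : IsMechanical w α) (i : ℕ) :
    x i ≤ betaValue β (fun n => ⌈α * n⌉) := by
  have hβ0 : 0 < β := by linarith
  have hc0 : 0 < β⁻¹ := by positivity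
  have hc1 : β⁻¹ < 1 := inv_lt_one_of_one_lt₀ hβ
  refine le_betaValue hβ (linearGrowth_ceil α) (A := α) (B := 2) fun N => ?_
  conv_lhs => rw [h.eq_partial_sum hβ0 i N]
  refine add_le_add ?_ ?_
  · refine mul_le_mul_of_nonneg_left (Finset.sum_le_sum fun n hn => ?_) (by linarith)
    refine mul_le_mul_of_nonneg_right ?_ (pow_pos hc0 n).le
    exact_mod_cast hw.factorSum_le_ceil i n
  · refine mul_le_mul_of_nonneg_left ?_ (pow_pos hc0 N).le
    have : (factorSum w i N : ℝ) ≤ ⌈α * N⌉ := by exact_mod_cast hw.factorSum_le_ceil i N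
    linarith [Int.ceil_lt_add_one (α * N), h.le_one (i + N)]

lemma betaValue_floor_le (h : IsBetaOrbit β x w) (hw : IsMechanical w α) (i : ℕ) :
    betaValue β (fun n => ⌊α * n⌋) ≤ x i := by
  have hβ0 : 0 < β := by linarith
  have hc0 : 0 < β⁻¹ := by positivity
  have hc1 : β⁻¹ < 1 := inv_lt_one_of_one_lt₀ hβ
  refine betaValue_le hβ (linearGrowth_floor α) fun N => ?_
  rw [h.eq_partial_sum hβ0 i N]
  have hpos : 0 ≤ β⁻¹ ^ N * (factorSum w i N + x (i + N)) := by
    have : (0 : ℝ) ≤ factorSum w i N := by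
      exact_mod_cast factorSum_nonneg (h.nonneg hβ0) i N
    have := h.pos (i + N)
    positivity
  refine le_trans ?_ (le_add_of_nonneg_right hpos)
  refine mul_le_mul_of_nonneg_left (Finset.sum_le_sum fun n hn => ?_) (by linarith)
  refine mul_le_mul_of_nonneg_right ?_ (pow_pos hc0 n).le
  exact_mod_cast hw.floor_le_factorSum i n

omit hβ in
lemma bddAbove (h : IsBetaOrbit β x w) : BddAbove (Set.range x) :=
  ⟨1, by rintro _ ⟨n, rfl⟩; exact h.le_one n⟩

omit hβ in
lemma bddBelow (h : IsBetaOrbit β x w) : BddBelow (Set.range x) :=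
  ⟨0, by rintro _ ⟨n, rfl⟩; exact (h.pos n).le⟩

lemma iSup_sub_iInf_eq (h : IsBetaOrbit β x w) (ht : ∀ i j, |x i - x j| ≤ β⁻¹)
    (hw : IsMechanical w α) :
    (⨆ n, x n) - ⨅ n, x n = (1 - β⁻¹) * ∑' n : ℕ, ((⌈α * n⌉ : ℝ) - ⌊α * n⌋) * β⁻¹ ^ n := by
  have h1 : (⨆ n, x n) = betaValue β (fun n => ⌈α * n⌉) :=
    le_antisymm (ciSup_le (h.le_betaValue_ceil hβ hw))
      (h.betaValue_ceil_le hβ ht hw.hasSlope (le_ciSup h.bddAbove))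
  have h2 : (⨅ n, x n) = betaValue β (fun n => ⌊α * n⌋) :=
    le_antisymm (h.le_betaValue_floor hβ ht hw.hasSlope (ciInf_le h.bddBelow))
      (le_ciInf (h.betaValue_floor_le hβ hw))
  rw [h1, h2, betaValue, betaValue, ← mul_sub, ← ((linearGrowth_ceil α).summable hβ).tsum_sub
    ((linearGrowth_floor α).summable hβ)]
  simp only [sub_mul]

end IsBetaOrbit

lemma hasSum_pow_of_ne_zero :
    HasSum (fun n : ℕ => (if n = 0 then (0 : ℝ) else 1) * β⁻¹ ^ n) (β⁻¹ / (1 - β⁻¹)) := by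
  have hc0 : 0 < β⁻¹ := by positivity
  have hc1 : β⁻¹ < 1 := inv_lt_one_of_one_lt₀ hβ
  have h1 := hasSum_geometric_of_lt_one hc0.le hc1
  have h2 := h1.sub (hasSum_ite_eq 0 (1 : ℝ))
  rw [show (1 - β⁻¹)⁻¹ - 1 = β⁻¹ / (1 - β⁻¹) by
    have : 1 - β⁻¹ ≠ 0 := by linarith
    rw [eq_div_iff this, sub_mul, inv_mul_cancel₀ this]; ring] at h2
  have e : (fun n : ℕ => (if n = 0 then (0 : ℝ) else 1) * β⁻¹ ^ n) =
      fun n => β⁻¹ ^ n - if n = 0 then 1 else 0 := by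
    funext n
    split_ifs with h <;> simp [h]
  rw [e]
  exact h2

/-- Adding one to all partial sums with `n ≥ 1` raises the first digit by one, hence the value by
`β⁻¹`. -/
lemma hasSum_floor_add_one (α : ℝ) :
    HasSum (fun n : ℕ => ((⌊α * n⌋ : ℝ) + if n = 0 then 0 else 1) * β⁻¹ ^ n)
      ((betaValue β (fun n => ⌊α * n⌋) + β⁻¹) / (1 - β⁻¹)) := by
  have hc1 : 1 - β⁻¹ ≠ 0 := by linarith [inv_lt_one_of_one_lt₀ hβ]
  simp only [add_mul]
  rw [add_div, betaValue, mul_div_cancel_left₀ _ hc1]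
  exact ((linearGrowth_floor α).summable hβ).hasSum.add (hasSum_pow_of_ne_zero hβ)

/-- For irrational `α` the ceiling and the floor of `α n` differ by one at every `n ≥ 1`. -/
lemma tsum_ceil_sub_floor_irrational {α : ℝ} (hα : Irrational α) :
    (1 - β⁻¹) * ∑' n : ℕ, ((⌈α * n⌉ : ℝ) - ⌊α * n⌋) * β⁻¹ ^ n = 1 / β := by
  have hc1 : β⁻¹ < 1 := inv_lt_one_of_one_lt₀ hβ
  have : ∀ n : ℕ, ((⌈α * n⌉ : ℝ) - ⌊α * n⌋) = if n = 0 then (0 : ℝ) else 1 := fun n => by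
    split_ifs with h
    · simp [h]
    · have h1 : Int.fract (α * n) ≠ 0 := fun h2 => by
        obtain ⟨z, hz⟩ := Int.fract_eq_zero_iff.1 h2
        exact (hα.mul_natCast h) ⟨z, by rw [← hz]; simp⟩
      rw [Int.ceil_eq_add_one_sub_fract h1, Int.fract]
      ring
  simp only [this]
  rw [(hasSum_pow_of_ne_zero hβ).tsum_eq, mul_div_cancel₀ _ (by linarith), one_div]

/-- The ceiling and the floor of `r n` differ by one unless the denominator divides `n`, so the
series is a difference of two geometric series. -/
lemma tsum_ceil_sub_floor_rational (r : ℚ) :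
    (1 - β⁻¹) * ∑' n : ℕ, ((⌈(r : ℝ) * n⌉ : ℝ) - ⌊(r : ℝ) * n⌋) * β⁻¹ ^ n =
      (β ^ (r.den - 1) - 1) / (β ^ r.den - 1) := by
  have hc0 : 0 < β⁻¹ := by positivity
  have hc1 : β⁻¹ < 1 := inv_lt_one_of_one_lt₀ hβ
  have hq := r.den_pos
  have hr : (r : ℝ) * r.den = r.num := by exact_mod_cast Rat.mul_den_eq_num r
  have key (n : ℕ) : ((⌈(r : ℝ) * n⌉ : ℝ) - ⌊(r : ℝ) * n⌋) = 1 - if r.den ∣ n then (1 : ℝ) else 0 := by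
    split_ifs with h
    · obtain ⟨k, rfl⟩ := h
      have : (r : ℝ) * (r.den * k : ℕ) = (r.num * k : ℤ) := by
        push_cast; rw [← mul_assoc, hr]
      rw [this, Int.ceil_intCast, Int.floor_intCast]; simp
    · have h1 : Int.fract ((r : ℝ) * n) ≠ 0 := fun h2 => h <| by
        obtain ⟨z, hz⟩ := Int.fract_eq_zero_iff.1 h2
        have h3 : (z * r.den : ℝ) = r.num * n := by rw [hz, ← hr]; ring
        have h4 : z * r.den = r.num * n := by exact_mod_cast h3
        have h5 : (r.den : ℤ) ∣ r.num * n := ⟨z, by rw [← h4]; ring⟩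
        have h6 : IsCoprime (r.den : ℤ) r.num := by
          rw [Int.isCoprime_iff_nat_coprime]
          simpa using r.reduced.symm
        exact_mod_cast h6.dvd_of_dvd_mul_left h5
      rw [Int.ceil_eq_add_one_sub_fract h1, Int.fract]
      ring
  have h1 := hasSum_geometric_of_lt_one hc0.le hc1
  have hcq : β⁻¹ ^ r.den < 1 := pow_lt_one₀ hc0.le hc1 hq.ne'
  have h2 : HasSum (fun n : ℕ => (if r.den ∣ n then (1 : ℝ) else 0) * β⁻¹ ^ n)
      (1 - β⁻¹ ^ r.den)⁻¹ := by
    have h3 := hasSum_geometric_of_lt_one (pow_pos hc0 r.den).le hcq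
    have hinj : Function.Injective fun k : ℕ => r.den * k := mul_right_injective₀ hq.ne'
    rw [← hinj.hasSum_iff]
    · convert h3 using 2 with k
      simp [pow_mul]
    · intro n hn
      rw [if_neg, zero_mul]
      rintro ⟨k, rfl⟩
      exact hn ⟨k, rfl⟩
  rw [tsum_congr fun n => by rw [key, sub_mul, one_mul], (h1.sub h2).tsum_eq]
  obtain ⟨k, hk⟩ := Nat.exists_eq_succ_of_ne_zero hq.ne'
  rw [hk] at hcq ⊢
  simp only [Nat.succ_eq_add_one, Nat.add_sub_cancel] at hcq ⊢
  have hβk : 1 < β ^ (k + 1) := one_lt_pow₀ hβ (by omega)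
  have n1 : 1 - β⁻¹ ≠ 0 := by linarith
  have n2 : 1 - β⁻¹ ^ (k + 1) ≠ 0 := by linarith
  have n3 : β ^ (k + 1) - 1 ≠ 0 := by linarith
  have n4 : β ≠ 0 := by positivity
  rw [mul_sub, mul_inv_cancel₀ n1, eq_div_iff n3]
  have e : β ^ (k + 1) - 1 = β ^ (k + 1) * (1 - β⁻¹ ^ (k + 1)) := by
    rw [mul_sub, ← mul_pow, mul_inv_cancel₀ n4]; simp
  rw [e]
  have e2 : (1 - (1 - β⁻¹) * (1 - β⁻¹ ^ (k + 1))⁻¹) * (β ^ (k + 1) * (1 - β⁻¹ ^ (k + 1))) =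
      β ^ (k + 1) * (1 - β⁻¹ ^ (k + 1)) - (1 - β⁻¹) * β ^ (k + 1) := by
    linear_combination (-(1 - β⁻¹) * β ^ (k + 1)) * mul_inv_cancel₀ n2
  rw [e2, ← e, pow_succ]
  field_simp
  ring

/-! ### The frequency of the top interval -/

/-- For `n ≥ 1`, `⌈α' n⌉` is at least `⌊α n⌋ + 1`, and the latter sequence already has value at
least `1 - β⁻¹ + β⁻¹ = 1`. The inequality is strict at large `n`. -/
lemma one_lt_betaValue_ceil {α α' : ℝ} (hlt : α < α')
    (h : 1 - β⁻¹ ≤ betaValue β fun n => ⌊α * n⌋) : 1 < betaValue β fun n => ⌈α' * n⌉ := by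
  have hc0 : 0 < β⁻¹ := by positivity
  have hc1 : β⁻¹ < 1 := inv_lt_one_of_one_lt₀ hβ
  have hs := hasSum_floor_add_one hβ α
  have h1 : 1 ≤ (1 - β⁻¹) * ∑' n : ℕ, ((⌊α * n⌋ : ℝ) + if n = 0 then 0 else 1) * β⁻¹ ^ n := by
    rw [hs.tsum_eq, mul_div_cancel₀ _ (by linarith)]
    linarith
  refine h1.trans_lt (mul_lt_mul_of_pos_left ?_ (by linarith))
  have hge (n : ℕ) : ((⌊α * n⌋ : ℝ) + if n = 0 then 0 else 1) ≤ ⌈α' * n⌉ := by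
    split_ifs with hn
    · simp [hn]
    · have hn' : (0 : ℝ) < n := by exact_mod_cast Nat.pos_of_ne_zero hn
      have : ⌊α * n⌋ < ⌈α' * n⌉ := by
        rw [Int.lt_ceil]
        exact (Int.floor_le _).trans_lt (mul_lt_mul_of_pos_right hlt hn')
      exact_mod_cast this
  obtain ⟨m, hm⟩ := exists_nat_gt (2 / (α' - α))
  rw [div_lt_iff₀ (by linarith)] at hm
  have hm0 : m ≠ 0 := by rintro rfl; simp at hm; linarith
  refine Summable.tsum_lt_tsum (i := m)
    (fun n => mul_le_mul_of_nonneg_right (hge n) (pow_pos hc0 n).le)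
    (mul_lt_mul_of_pos_right ?_ (pow_pos hc0 m))
    hs.summable
    ((linearGrowth_ceil α').summable hβ)
  rw [if_neg hm0]
  linarith [Int.le_ceil (α' * m), Int.floor_le (α * m)]

/-- There is a slope for which the upper value is at most `1` and the lower value is at least
`1 - 1/β`. -/
lemma exists_top_slope : ∃ α : ℝ, 0 ≤ α ∧ betaValue β (fun n => ⌈α * n⌉) ≤ 1 ∧
    1 - β⁻¹ ≤ betaValue β (fun n => ⌊α * n⌋) := by
  have hc0 : 0 < β⁻¹ := by positivity
  have hc1 : β⁻¹ < 1 := inv_lt_one_of_one_lt₀ hβ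
  have hc2 : 0 < 1 - β⁻¹ := by linarith
  set S : Set ℝ := {α | 0 ≤ α ∧ betaValue β (fun n => ⌈α * n⌉) ≤ 1} with hS
  have partial_le {α : ℝ} (hα : α ∈ S) (s : Finset ℕ) :
      (1 - β⁻¹) * ∑ n ∈ s, (⌈α * n⌉ : ℝ) * β⁻¹ ^ n ≤ 1 := by
    refine le_trans (mul_le_mul_of_nonneg_left ?_ hc2.le) hα.2
    refine ((linearGrowth_ceil α).summable hβ).sum_le_tsum s fun n _ => ?_
    have : (0 : ℝ) ≤ ⌈α * n⌉ := (mul_nonneg hα.1 n.cast_nonneg).trans (Int.le_ceil _)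
    positivity
  have hne : S.Nonempty := ⟨0, le_rfl, by simp [betaValue]⟩
  have hbdd : BddAbove S := by
    refine ⟨((1 - β⁻¹) * β⁻¹)⁻¹, fun α hα => ?_⟩
    have h1 := partial_le hα {1}
    simp only [Finset.sum_singleton, Nat.cast_one, mul_one, pow_one] at h1
    rw [← one_div, le_div_iff₀ (mul_pos hc2 hc0)]
    have h2 := mul_le_mul_of_nonneg_right (Int.le_ceil α) (mul_pos hc2 hc0).le
    linarith
  refine ⟨sSup S, le_csSup hbdd hne.some_mem |> hne.some_mem.1.trans, ?_, ?_⟩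
  -- The ceiling is lower semicontinuous, so each truncated sum at the supremum is bounded by one at
  -- a nearby member of `S`.
  · obtain ⟨u, -, hu, huS⟩ := exists_seq_tendsto_sSup hne hbdd
    refine betaValue_le hβ (linearGrowth_ceil _) fun N => ?_
    have hev : ∀ᶠ k in atTop, ∀ n ∈ Finset.range N, ⌈sSup S * n⌉ ≤ ⌈u k * n⌉ := by
      rw [Finset.eventually_all]
      intro n _
      have h1 : Tendsto (fun k => u k * n) atTop (𝓝 (sSup S * n)) := hu.mul_const _
      have h2 : (⌈sSup S * n⌉ : ℝ) - 1 < sSup S * n := by linarith [Int.ceil_lt_add_one (sSup S * n)]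
      filter_upwards [h1.eventually_const_lt h2] with k hk
      have : ⌈sSup S * n⌉ - 1 < ⌈u k * n⌉ := by rw [Int.lt_ceil]; push_cast; exact hk
      omega
    obtain ⟨k, hk⟩ := hev.exists
    refine le_trans (mul_le_mul_of_nonneg_left (Finset.sum_le_sum fun n hn => ?_) hc2.le)
      (partial_le (huS k) (Finset.range N))
    exact mul_le_mul_of_nonneg_right (by exact_mod_cast hk n hn) (pow_pos hc0 n).le
  · set a := sSup S with ha
    have ha0 : 0 ≤ a := le_csSup hbdd hne.some_mem |> hne.some_mem.1.trans
    -- Slopes decreasing to `a` lie outside `S`, so their ceiling values exceed 1, while `⌈v k * n⌉`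
    -- tends to `⌊a * n⌋ + 1` for `n ≥ 1`.
    set v : ℕ → ℝ := fun k => a + 1 / ((k : ℝ) + 1) with hv
    have hva (k : ℕ) : a < v k := lt_add_of_pos_right _ Nat.one_div_pos_of_nat
    have hv1 (k : ℕ) : v k ≤ a + 1 := by
      have := Nat.one_div_le_one_div (α := ℝ) (Nat.zero_le k)
      simp [hv] at this ⊢
      exact this
    have hvt : Tendsto v atTop (𝓝 a) := by
      simpa [hv] using (tendsto_one_div_add_atTop_nhds_zero_nat (𝕜 := ℝ)).const_add a
    have hlim : Tendsto (fun k => ∑' n : ℕ, (⌈v k * n⌉ : ℝ) * β⁻¹ ^ n) atTop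
        (𝓝 (∑' n : ℕ, ((⌊a * n⌋ : ℝ) + if n = 0 then 0 else 1) * β⁻¹ ^ n)) := by
      refine tendsto_tsum_of_dominated_convergence (summable_linear_mul_pow hβ (a + 1) 1)
        (fun n => ?_) (Eventually.of_forall fun k n => ?_)
      · refine tendsto_const_nhds.congr' ?_
        rcases Nat.eq_zero_or_pos n with rfl | hn
        · simp
        have hn' : (0 : ℝ) < n := by exact_mod_cast hn
        have h1 : Tendsto (fun k => v k * n) atTop (𝓝 (a * n)) := hvt.mul_const _
        filter_upwards [h1.eventually_lt_const (Int.lt_floor_add_one (a * n))] with k hk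
        rw [if_neg hn.ne']
        have : ⌈v k * n⌉ = ⌊a * n⌋ + 1 := Int.ceil_eq_iff.2 ⟨by
          push_cast
          linarith [Int.floor_le (a * n), mul_lt_mul_of_pos_right (hva k) hn'], by
          push_cast; exact hk.le⟩
        rw [this]; push_cast; rfl
      · have h0 : 0 ≤ v k * n := mul_nonneg (ha0.trans (hva k).le) n.cast_nonneg
        have h1 : (0 : ℝ) ≤ ⌈v k * n⌉ := h0.trans (Int.le_ceil _)
        rw [Real.norm_of_nonneg (by positivity)]
        refine mul_le_mul_of_nonneg_right ?_ (pow_pos hc0 n).le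
        linarith [Int.ceil_lt_add_one (v k * n),
          mul_le_mul_of_nonneg_right (hv1 k) (n.cast_nonneg : (0 : ℝ) ≤ n)]
    have h1 : 1 ≤ (1 - β⁻¹) * ∑' n : ℕ, ((⌊a * n⌋ : ℝ) + if n = 0 then 0 else 1) * β⁻¹ ^ n := by
      refine ge_of_tendsto' (hlim.const_mul (1 - β⁻¹)) fun k => ?_
      by_contra! hk
      exact (hva k).not_ge (le_csSup hbdd ⟨ha0.trans (hva k).le, hk.le⟩)
    rw [(hasSum_floor_add_one hβ a).tsum_eq, mul_div_cancel₀ _ (by linarith)] at h1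
    linarith

end

end Orbits

section TopFrequency

open Filter Topology

/-! ### Existence and uniqueness of the top frequency -/

lemma hasFrequency_iff_hasSlope (β x α : ℝ) :
    HasFrequency β x α ↔ HasSlope (betaExpansion β x) α := by
  simp [HasFrequency, HasSlope, factorSum]

lemma abs_sub_le_of_mem_Icc {a b s t : ℝ} (hs : s ∈ Set.Icc a b) (ht : t ∈ Set.Icc a b) :
    |s - t| ≤ b - a := by
  rw [abs_le]
  constructor <;> linarith [hs.1, hs.2, ht.1, ht.2]

lemma IsTopFrequency.bounds {β α : ℝ} (hβ : 1 < β) (h : IsTopFrequency β α) :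
    betaValue β (fun n => ⌈α * n⌉) ≤ 1 ∧ 1 - β⁻¹ ≤ betaValue β (fun n => ⌊α * n⌋) := by
  obtain ⟨x, hx, hsub, -, hfreq⟩ := h
  have hmem (n : ℕ) : (betaMap β)^[n] x ∈ Set.Icc (1 - β⁻¹) 1 := by
    rw [← one_div]
    exact hsub (subset_closure ⟨n, rfl⟩)
  have h0 : 0 < x := by
    have := (hmem 0).1
    simp only [Function.iterate_zero, id] at this
    linarith [inv_lt_one_of_one_lt₀ hβ]
  have hO := isBetaOrbit_iterate β h0 hx.2
  have hα := (hasFrequency_iff_hasSlope _ _ _).1 (hfreq x (subset_closure ⟨0, rfl⟩))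
  have ht (i j : ℕ) : |(betaMap β)^[i] x - (betaMap β)^[j] x| ≤ β⁻¹ :=
    (abs_sub_le_of_mem_Icc (hmem i) (hmem j)).trans_eq (by ring)
  exact ⟨hO.betaValue_ceil_le hβ ht hα fun i => (hmem i).2,
    hO.le_betaValue_floor hβ ht hα fun i => (hmem i).1⟩

/-- The only discontinuities are jumps from 1 down to values near 0, just to the right of the points
where `β * y` is an integer. A set whose images stay above `δ` avoids them. -/
lemma continuousWithinAt_betaMap {β δ : ℝ} {A : Set ℝ} (hδ : 0 < δ)
    (hA : ∀ z ∈ A, δ ≤ betaMap β z) (y : ℝ) : ContinuousWithinAt (betaMap β) A y := by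
  have hc : Continuous fun z : ℝ => β * z := continuous_const_mul β
  have h1 : ((⌈β * y⌉ : ℝ) - 1) < β * y := by linarith [Int.ceil_lt_add_one (β * y)]
  have h2 : β * y < ⌈β * y⌉ + δ := by linarith [Int.le_ceil (β * y)]
  have hev : betaMap β =ᶠ[𝓝[A] y] fun z => β * z - (⌈β * y⌉ - 1) := by
    filter_upwards [self_mem_nhdsWithin,
      nhdsWithin_le_nhds (hc.continuousAt.eventually_const_lt h1),
      nhdsWithin_le_nhds (hc.continuousAt.eventually_lt_const h2)] with z hz hz1 hz2
    have hzA := hA z hz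
    rw [betaMap_eq_sub_ceil] at hzA ⊢
    have h3 : ⌈β * y⌉ - 1 < ⌈β * z⌉ := by rw [Int.lt_ceil]; push_cast; exact hz1
    have h4 : (⌈β * z⌉ : ℝ) < ⌈β * y⌉ + 1 := by linarith
    have h5 : ⌈β * z⌉ < ⌈β * y⌉ + 1 := by exact_mod_cast h4
    rw [show ⌈β * z⌉ = ⌈β * y⌉ by omega]
  refine ContinuousWithinAt.congr_of_eventuallyEq ?_ hev (betaMap_eq_sub_ceil β y)
  exact (hc.sub continuous_const).continuousWithinAt

/-- The upper mechanical word of slope `α` and intercept `0` is the expansion of a point whose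
orbit lies between the lower and the upper value of `α`. -/
lemma exists_isBetaOrbit_upperMechanical {β α : ℝ} (hβ : 1 < β) (h0 : 0 ≤ α)
    (hup : betaValue β (fun n => ⌈α * n⌉) ≤ 1)
    (hlow : 0 < betaValue β (fun n => ⌊α * n⌋)) :
    ∃ x : ℕ → ℝ, IsBetaOrbit β x (upperMechanical α 0) ∧
      x 0 = betaValue β (fun n => ⌈α * n⌉) ∧
      ∀ i, x i ∈ Set.Icc (betaValue β fun n => ⌊α * n⌋) (betaValue β fun n => ⌈α * n⌉) := by
  have hc0 : 0 < β⁻¹ := by positivity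
  have hc1 : 1 - β⁻¹ ≠ 0 := by linarith [inv_lt_one_of_one_lt₀ hβ]
  set w := upperMechanical α 0 with hw
  have hmech : IsMechanical w α := ⟨h0, 0, by simp, .inr rfl⟩
  -- The points are defined as values of the factor sums of the word; floor and ceiling bounds place
  -- them in `(0, 1]`, as an orbit requires.
  have hmem (i : ℕ) : betaValue β (factorSum w i) ∈
      Set.Icc (betaValue β fun n => ⌊α * n⌋) (betaValue β fun n => ⌈α * n⌉) :=
    ⟨betaValue_mono hβ (linearGrowth_floor α) (hmech.linearGrowth i) (hmech.floor_le_factorSum i),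
      betaValue_mono hβ (hmech.linearGrowth i) (linearGrowth_ceil α) (hmech.factorSum_le_ceil i)⟩
  refine ⟨fun i => betaValue β (factorSum w i), ⟨fun i => hlow.trans_le (hmem i).1,
    fun i => (hmem i).2.trans hup, fun i => ?_⟩, ?_, hmem⟩
  · have hs := (hmech.linearGrowth i).summable hβ
    have hs' := (hmech.linearGrowth (i + 1)).summable hβ
    have hg := hasSum_geometric_of_lt_one hc0.le (inv_lt_one_of_one_lt₀ hβ)
    simp only [betaValue]
    rw [hs.tsum_eq_zero_add]
    have : ∀ n : ℕ, (factorSum w i (n + 1) : ℝ) * β⁻¹ ^ (n + 1) =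
        β⁻¹ * (w i * β⁻¹ ^ n + factorSum w (i + 1) n * β⁻¹ ^ n) := fun n => by
      rw [factorSum_succ', pow_succ]; push_cast; ring
    simp only [this, factorSum_zero]
    rw [tsum_mul_left, (hg.summable.mul_left _).tsum_add hs', tsum_mul_left, hg.tsum_eq]
    have hβ' : β ≠ 0 := by positivity
    have e : β * ((1 - β⁻¹) * (((0 : ℤ) : ℝ) * β⁻¹ ^ 0 + β⁻¹ * (w i * (1 - β⁻¹)⁻¹ +
        ∑' n, (factorSum w (i + 1) n : ℝ) * β⁻¹ ^ n))) =
        (β * β⁻¹) * (((1 - β⁻¹) * (1 - β⁻¹)⁻¹) * w i +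
          (1 - β⁻¹) * ∑' n, (factorSum w (i + 1) n : ℝ) * β⁻¹ ^ n) := by
      push_cast; ring
    rw [e, mul_inv_cancel₀ hβ', mul_inv_cancel₀ hc1, one_mul, one_mul]
  · have : factorSum w 0 = fun n : ℕ => ⌈α * n⌉ := by
      funext n
      rw [hw, factorSum_upperMechanical]
      simp
    simp only [this]

/-- The orbit closure is that of the upper mechanical word of intercept 0. The bounds place it in an
interval of length `β⁻¹` away from 0, where the map is continuous on it and any two orbits can be
compared. -/
lemma isTopFrequency_of_bounds {β α : ℝ} (hβ : 1 < β) (h0 : 0 ≤ α)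
    (hup : betaValue β (fun n => ⌈α * n⌉) ≤ 1)
    (hlow : 1 - β⁻¹ ≤ betaValue β (fun n => ⌊α * n⌋)) : IsTopFrequency β α := by
  have hβ0 : 0 < β := by linarith
  have hc1 : 0 < 1 - β⁻¹ := by linarith [inv_lt_one_of_one_lt₀ hβ]
  obtain ⟨x, hO, hx0, hmem⟩ := exists_isBetaOrbit_upperMechanical hβ h0 hup (hc1.trans_le hlow)
  have hmech : IsMechanical (upperMechanical α 0) α := ⟨h0, 0, by simp, .inr rfl⟩
  have hI (i : ℕ) : x i ∈ Set.Icc (1 - β⁻¹) 1 := ⟨hlow.trans (hmem i).1, (hmem i).2.trans hup⟩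
  have ht (i j : ℕ) : |x i - x j| ≤ β⁻¹ :=
    (abs_sub_le_of_mem_Icc (hI i) (hI j)).trans_eq (by ring)
  have horb : betaOrbit β (x 0) = Set.range x := by
    simp only [betaOrbit, hO.iterate_eq]
  set K := closure (Set.range x) with hK
  have hKI : K ⊆ Set.Icc (1 - β⁻¹) 1 :=
    closure_minimal (by rintro _ ⟨i, rfl⟩; exact hI i) isClosed_Icc
  have hmaps : ∀ y ∈ K, betaMap β y ∈ K := fun y hy => by
    have hcw := continuousWithinAt_betaMap (β := β) (A := Set.range x) hc1
      (by rintro _ ⟨i, rfl⟩; rw [hO.betaMap_eq]; exact (hI _).1) y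
    refine closure_mono ?_ (hcw.mem_closure_image hy)
    rintro _ ⟨_, ⟨i, rfl⟩, rfl⟩
    exact ⟨i + 1, (hO.betaMap_eq i).symm⟩
  have hcont : ContinuousOn (betaMap β) K := fun y _ =>
    continuousWithinAt_betaMap hc1 (fun z hz => (hKI (hmaps z hz)).1) y
  have hKc : IsCompact K := isCompact_Icc.of_isClosed_subset isClosed_closure hKI
  have himg : IsClosed (betaMap β '' K) := (hKc.image_of_continuousOn hcont).isClosed
  have hsucc (i : ℕ) : x (i + 1) ∈ betaMap β '' K :=
    ⟨x i, subset_closure ⟨i, rfl⟩, hO.betaMap_eq i⟩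
  -- The starting point needs a preimage in `K`. It is the maximum of the orbit, and the shifted
  -- orbit has the same slope, hence the same supremum; so it is a limit of image points.
  have hzero : x 0 ∈ betaMap β '' K := by
    have hO1 := hO.shift 1
    have hsup : (⨆ n, x (1 + n)) = x 0 := by
      refine le_antisymm (ciSup_le fun n => hx0 ▸ (hmem _).2) ?_
      rw [hx0]
      exact hO1.betaValue_ceil_le hβ (fun i j => ht _ _)
        (isMechanical_shiftWord hmech 1).hasSlope (le_ciSup hO1.bddAbove)
    rw [← hsup]
    refine closure_minimal ?_ himg (csSup_mem_closure (Set.range_nonempty _) hO1.bddAbove)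
    rintro _ ⟨n, rfl⟩
    simpa only [add_comm 1 n] using hsucc n
  refine ⟨x 0, ⟨(hO.pos 0).le, hO.le_one 0⟩, ?_⟩
  rw [horb, one_div]
  refine ⟨hKI, Set.Subset.antisymm ?_ (closure_minimal ?_ himg), fun y hy => ?_⟩
  · rintro _ ⟨y, hy, rfl⟩
    exact hmaps y hy
  · rintro _ ⟨i, rfl⟩
    cases i with
    | zero => exact hzero
    | succ i => exact hsucc i
  · have hyK (n : ℕ) : (betaMap β)^[n] y ∈ K := by
      induction n with
      | zero => exact hy
      | succ n ih => rw [Function.iterate_succ_apply']; exact hmaps _ ih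
    have hyO := isBetaOrbit_iterate β (hc1.trans_le (hKI hy).1) (hKI hy).2
    -- Both orbits stay in an interval of length `β⁻¹`, so their letter sums differ by at most one
    -- and the slope carries over to every point of `K`.
    have hd (n : ℕ) : |x (0 + n) - (betaMap β)^[0 + n] y| ≤ β⁻¹ :=
      (abs_sub_le_of_mem_Icc (hI _) (hKI (hyK _))).trans_eq (by ring)
    rw [hasFrequency_iff_hasSlope]
    refine hasSlope_of_abs_sub_le (C := 2) fun n => ?_
    have h1 : (⌊α * n⌋ : ℝ) ≤ factorSum (upperMechanical α 0) 0 n := by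
      exact_mod_cast hmech.floor_le_factorSum 0 n
    have h2 : (factorSum (upperMechanical α 0) 0 n : ℝ) ≤ ⌈α * n⌉ := by
      exact_mod_cast hmech.factorSum_le_ceil 0 n
    have h3 : factorSum (betaExpansion β y) 0 n ≤ factorSum (upperMechanical α 0) 0 n + 1 ∧
        factorSum (upperMechanical α 0) 0 n ≤ factorSum (betaExpansion β y) 0 n + 1 := by
      rcases le_total (x 0) y with hle | hle
      · rcases hO.compare hyO hβ0 hd hle n with h | h <;> omega
      · rcases hyO.compare hO hβ0 (i := 0) (j := 0) (fun n => by rw [abs_sub_comm]; exact hd n) hle n with h | h <;>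
          omega
    have h4 : (factorSum (betaExpansion β y) 0 n : ℝ) ≤ factorSum (upperMechanical α 0) 0 n + 1 := by
      exact_mod_cast h3.1
    have h5 : (factorSum (upperMechanical α 0) 0 n : ℝ) ≤ factorSum (betaExpansion β y) 0 n + 1 := by
      exact_mod_cast h3.2
    rw [abs_le]
    constructor <;> linarith [Int.lt_floor_add_one (α * n), Int.ceil_lt_add_one (α * n)]

theorem existsUnique_isTopFrequency {β : ℝ} (hβ : 1 < β) : ∃! α : ℝ, IsTopFrequency β α := by
  obtain ⟨α, h0, hup, hlow⟩ := exists_top_slope hβ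
  refine ⟨α, isTopFrequency_of_bounds hβ h0 hup hlow, fun α' h' => ?_⟩
  obtain ⟨hup', hlow'⟩ := h'.bounds hβ
  rcases lt_trichotomy α' α with h | h | h
  · exact absurd hup (one_lt_betaValue_ceil hβ h hlow').not_ge
  · exact h
  · exact absurd hup' (one_lt_betaValue_ceil hβ h hlow).not_ge

lemma isTopFrequency_Freq {β : ℝ} (hβ : 1 < β) : IsTopFrequency β (Freq β) :=
  Classical.epsilon_spec (existsUnique_isTopFrequency hβ).exists

/-! ### Orbits of small diameter -/

lemma betaMap_iterate_mem_Icc (β : ℝ) {x : ℝ} (hx : x ∈ Set.Icc (0 : ℝ) 1) (n : ℕ) :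
    (betaMap β)^[n] x ∈ Set.Icc (0 : ℝ) 1 := by
  cases n with
  | zero => exact hx
  | succ n =>
    rw [Function.iterate_succ_apply']
    exact ⟨(betaMap_pos _ _).le, betaMap_le_one _ _⟩

lemma abs_sub_le_betaDiam (β : ℝ) {x : ℝ} (hx : x ∈ Set.Icc (0 : ℝ) 1) (i j : ℕ) :
    |(betaMap β)^[i] x - (betaMap β)^[j] x| ≤ betaDiam β x := by
  have ha : BddAbove (Set.range fun n : ℕ => (betaMap β)^[n] x) :=
    ⟨1, by rintro _ ⟨n, rfl⟩; exact (betaMap_iterate_mem_Icc β hx n).2⟩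
  have hb : BddBelow (Set.range fun n : ℕ => (betaMap β)^[n] x) :=
    ⟨0, by rintro _ ⟨n, rfl⟩; exact (betaMap_iterate_mem_Icc β hx n).1⟩
  exact abs_sub_le_of_mem_Icc ⟨ciInf_le hb i, le_ciSup ha i⟩ ⟨ciInf_le hb j, le_ciSup ha j⟩

/-- The point 0 is sent to 1, so its orbit has diameter at least `1 > 1 / β`. -/
lemma pos_of_betaDiam_le {β x : ℝ} (hβ : 1 < β) (hx : x ∈ Set.Icc (0 : ℝ) 1)
    (hd : betaDiam β x ≤ 1 / β) : 0 < x := by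
  refine lt_of_le_of_ne hx.1 ?_
  rintro rfl
  have h1 := abs_sub_le_betaDiam β hx 1 0
  have h2 : betaMap β 0 = 1 := by rw [betaMap_eq_sub_ceil]; simp
  simp only [Function.iterate_one, Function.iterate_zero, id, h2] at h1
  have h3 : 1 / β < 1 := by rw [div_lt_one (by linarith)]; exact hβ
  norm_num at h1
  linarith

end TopFrequency

/-! ### The classification -/

theorem theorem5 (β ξ : ℝ) (hβ : 1 < β) (hξ : ξ ∈ Set.Icc (0 : ℝ) 1)
    (hdiam : betaDiam β ξ ≤ 1 / β) :
    (∃! α : ℝ, IsTopFrequency β α) ∧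
    (SturmianCase β ξ ∨ MechanicalCase β ξ ∨ SkewCase β ξ) ∧
    ¬ (SturmianCase β ξ ∧ MechanicalCase β ξ) ∧
    ¬ (SturmianCase β ξ ∧ SkewCase β ξ) ∧
    ¬ (MechanicalCase β ξ ∧ SkewCase β ξ) := by
  have hβ0 : 0 < β := by linarith
  have hO := isBetaOrbit_iterate β (pos_of_betaDiam_le hβ hξ hdiam) hξ.2
  have ht (i j : ℕ) : |(betaMap β)^[i] ξ - (betaMap β)^[j] ξ| ≤ β⁻¹ :=
    (abs_sub_le_betaDiam β hξ i j).trans (by rwa [← one_div])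
  have hb := hO.sumBalanced hβ0 ht
  -- A skew word is mechanical only after a prefix; balance ensures that removing the prefix leaves
  -- the slope unchanged.
  have skew_slope {r : ℚ} (h : IsSkew (betaExpansion β ξ) r) :
      HasSlope (betaExpansion β ξ) r := by
    obtain ⟨α, hα⟩ := hb.exists_hasSlope (hO.nonneg hβ0)
    obtain ⟨-, -, m, -, hm⟩ := h
    rwa [hm.hasSlope.unique (hα.shiftWord hb m)]
  refine ⟨existsUnique_isTopFrequency hβ, ?_, ?_, ?_, ?_⟩
  · obtain ⟨α, hα⟩ := hb.exists_hasSlope (hO.nonneg hβ0)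
    -- A slope above `Freq β` would have ceiling value above 1, yet that value is at most any upper
    -- bound of the orbit, in particular 1.
    have hle : α ≤ Freq β := by
      by_contra! h
      exact (one_lt_betaValue_ceil hβ h ((isTopFrequency_Freq hβ).bounds hβ).2).not_ge
        (hO.betaValue_ceil_le hβ ht hα hO.le_one)
    rcases hb.isMechanical_or_isSkew (hα.nonneg (hO.nonneg hβ0)) hα with hm | ⟨r, rfl, hs⟩
    · have hd := hO.iSup_sub_iInf_eq hβ ht hm
      by_cases hirr : Irrational α
      · exact .inl ⟨⟨α, hle, hirr, hm⟩, hd.trans (tsum_ceil_sub_floor_irrational hβ hirr)⟩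
      · obtain ⟨r, rfl⟩ := not_not.1 hirr
        exact .inr (.inl ⟨r, hle, hm, hd.trans (tsum_ceil_sub_floor_rational hβ r)⟩)
    · refine .inr (.inr ⟨r, hle, hs, ?_⟩)
      obtain ⟨-, -, m, -, hm⟩ := hs
      refine ⟨m, fun k hk => ?_⟩
      obtain ⟨l, rfl⟩ := Nat.exists_eq_add_of_le hk
      -- Every tail beyond the prefix is mechanical of the same slope, so the diameter formula
      -- applies to each of them.
      have hml : IsMechanical (shiftWord (m + l) (betaExpansion β ξ)) r := by
        have e : shiftWord (m + l) (betaExpansion β ξ) =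
            shiftWord l (shiftWord m (betaExpansion β ξ)) :=
          funext fun n => congrArg _ (add_assoc m l n)
        exact e ▸ isMechanical_shiftWord hm l
      have hd := (hO.shift (m + l)).iSup_sub_iInf_eq hβ (fun i j => ht _ _) hml
      rw [← tsum_ceil_sub_floor_rational hβ r, ← hd, betaDiam]
      simp only [← Function.iterate_add_apply, add_comm]
  · rintro ⟨⟨⟨α, -, hirr, hm⟩, -⟩, r, -, hm', -⟩
    exact hirr ⟨r, hm'.hasSlope.unique hm.hasSlope⟩
  · rintro ⟨⟨⟨α, -, hirr, hm⟩, -⟩, r, -, hs, -⟩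
    exact hirr ⟨r, (skew_slope hs).unique hm.hasSlope⟩
  · rintro ⟨⟨r, -, hm, -⟩, r', -, hs, -⟩
    exact hs.2.1 (isRecurrent_of_periodic r.den_pos hm.periodic)
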